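/- **Lemma 4.2.** Let $\mathfrak{U}$ be a Grothendieck universe and let $\mathbf{A}$ be an essentially $\mathfrak{U}$-small Abelian category which is Noetherian, i.e., for each object $X$ of $\mathbf{A}$, each non-empty set of subobjects of $X$ contains a maximal element. Let $\operatorname{Ind}(\mathbf{A})$ denote its category of ind-objects (formal colimits of $\mathfrak{U}$-small filtered diagrams in $\mathbf{A}$), which is again Abelian, and regard $\mathbf{A}$ as a full subcategory of $\operatorname{Ind}(\mathbf{A})$ by the Yoneda embedding. For an object $A$ of $\mathbf{A}$, let $$\operatorname{hdim}(A) := \sup\{m \in \mathbf{Z}_{\geq 0} \mid \exists B \in \mathbf{A}\ [\operatorname{Ext}^m_{\mathbf{A}}(A, B) \neq 0]\} \in \mathbf{Z}_{\geq 0} \cup \{\infty\},$$ where the supremum of the empty set is $0$. Let $A$ be an object of $\mathbf{A}$ and let $n \geq 0$ be an integer such that $\operatorname{hdim}(A) < n$. Then $\operatorname{Ext}^n_{\operatorname{Ind}(\mathbf{A})}(A, B) = 0$ for every object $B$ of $\operatorname{Ind}(\mathbf{A})$. -/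

import Mathlib

universe w v u

namespace CategoryTheory

open Limits Abelian

/-! ### The category of ind-objects of an abelian category is abelian

Mathlib equips `Ind C` with its abelian structure when `C : Type v` is a small abelian category
with morphisms in `Type v`. Here the same structure is put on `Ind C` for an abelian category
`C : Type u` with morphisms in `Type v` (in particular for every essentially `v`-small one). -/

section IndLeftExact

variable {C : Type u} [Category.{v} C]

/-- An ind-object, seen as a presheaf, is left exact: it is a filtered colimit of representables. -/
lemma Ind.preservesFiniteLimits_inclusion_obj (X : Ind C) :
    PreservesFiniteLimits ((Ind.inclusion C).obj X) := by
  let P := X.presentation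
  have e : (P.F ⋙ CategoryTheory.yoneda).flip ⋙ colim ≅ (Ind.inclusion C).obj X :=
    (colimitIsoFlipCompColim _).symm ≪≫
      (colimit.isColimit _).coconePointUniqueUpToIso P.isColimit
  have h : PreservesFiniteLimits (P.F ⋙ CategoryTheory.yoneda).flip := by
    refine ⟨fun J _ _ => ?_⟩
    apply preservesLimitsOfShape_of_evaluation
    intro k
    exact inferInstanceAs (PreservesLimitsOfShape J (CategoryTheory.yoneda.obj (P.F.obj k)))
  have := comp_preservesFiniteLimits (P.F ⋙ CategoryTheory.yoneda).flip
    (colim : (P.I ⥤ Type v) ⥤ Type v)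
  exact preservesFiniteLimits_of_natIso e

variable (C) in
/-- The inclusion of the ind-objects into the left exact presheaves. -/
noncomputable def Ind.toLeftExactFunctor : Ind C ⥤ (Cᵒᵖ ⥤ₗ Type v) :=
  ObjectProperty.lift _ (Ind.inclusion C) Ind.preservesFiniteLimits_inclusion_obj

variable (C) in
/-- The inclusion of the ind-objects into the left exact presheaves is fully faithful. -/
noncomputable def Ind.fullyFaithfulToLeftExactFunctor :
    (Ind.toLeftExactFunctor C).FullyFaithful :=
  .ofCompFaithful (G := ObjectProperty.ι _) Ind.inclusion.fullyFaithful

end IndLeftExact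

section IndAbelian

variable {C : Type u} [Category.{v} C] [Abelian C]

/-- The group structure on the morphisms of `Ind C`: left exact presheaves of sets on an additive
category are the same as left exact presheaves of abelian groups. -/
noncomputable instance Ind.instPreadditiveOfAbelian : Preadditive (Ind C) :=
  haveI : HasFiniteBiproducts Cᵒᵖ := HasFiniteBiproducts.of_hasFiniteCoproducts
  .ofFullyFaithful
    (((Ind.fullyFaithfulToLeftExactFunctor C).comp
      (AddCommGrpCat.leftExactFunctorForgetEquivalence Cᵒᵖ).symm.fullyFaithfulFunctor).comp
        (ObjectProperty.fullyFaithfulι _))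

instance Ind.instHasFiniteBiproductsOfAbelian : HasFiniteBiproducts (Ind C) :=
  HasFiniteBiproducts.of_hasFiniteCoproducts

instance Ind.isIso_coimageImageComparison {X Y : Ind C} (f : X ⟶ Y) :
    IsIso (Abelian.coimageImageComparison f) := by
  obtain ⟨I, _, _, F, G, φ, ⟨i⟩⟩ := Ind.exists_nonempty_arrow_mk_iso_ind_lim (f := f)
  let i' := coimageImageComparisonFunctor.mapIso i
  change Arrow.mk (coimageImageComparison f) ≅
    Arrow.mk (coimageImageComparison ((Ind.lim I).map φ)) at i'
  have := Iso.isIso_hom i'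
  rw [Arrow.isIso_iff_isIso_of_isIso i'.hom,
    Arrow.isIso_iff_isIso_of_isIso (PreservesCoimageImageComparison.iso (Ind.lim I) φ).inv]
  infer_instance

/-- The category of ind-objects of an abelian category is abelian. -/
noncomputable instance Ind.instAbelianOfAbelian : Abelian (Ind C) :=
  .ofCoimageImageComparisonIsIso

end IndAbelian

section HomologicalDimension

variable {C : Type u} [Category.{v} C] [Abelian C]

/-- The homological dimension of an object `A` of an abelian category `C`: the supremum in
`ℕ ∪ {∞}` of the `n` such that `Ext^n(A, B) ≠ 0` for some object `B` of `C`. The supremum of the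
empty set is `0`. (`HasExt.standard` makes the `Ext`-groups of `C` available without any
assumption; they do not depend on the universe in which they are formed.) -/
noncomputable def homologicalDimension (A : C) : ℕ∞ :=
  letI := HasExt.standard C
  sSup {d : ℕ∞ | ∃ n : ℕ, d = n ∧ ∃ B : C, Nontrivial (Ext.{max u v} A B n)}

end HomologicalDimension

end CategoryTheory

/-! The embedding of `C` into `Ind C` is exact, and every epimorphism of `Ind C` onto an object of
`C` is dominated by an epimorphism of `C` (`Ind.exists_epi_lift`). Since positive-degree classes are
killed by some epimorphism onto their source, dimension shifting along kernels formed in `C` shows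
that each class in `Ext^n(A, B)` is the pushforward, along some `B' ⟶ B` with `B'` in `C`, of a
class from `Ext^n_C(A, B')`. That group vanishes when `hdim A < n`. -/

namespace CategoryTheory

open Limits Abelian Opposite

section Effaceable

variable {D : Type u} [Category.{v} D] [Abelian D]

/-- The component in degree `n` of a quasi-isomorphism from a complex concentrated in
degrees `≤ n` to an object placed in degree `n` is an epimorphism. -/
lemma CochainComplex.epi_f_of_quasiIso_single {K : CochainComplex D ℤ} {n : ℤ} [K.IsStrictlyLE n]
    {X : D} (s : K ⟶ (CochainComplex.singleFunctor D n).obj X) [QuasiIso s] : Epi (s.f n) := by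
  -- In degree `n` everything is a cycle on both sides, and the target's cycles are its homology. So
  -- `s.f n` is essentially `K^n ⟶ H^n(K) ≅ X`.
  have hd (L : CochainComplex D ℤ) [L.IsStrictlyLE n] : L.d n (n + 1) = 0 :=
    (L.isZero_of_isStrictlyLE n (n + 1) (by lia)).eq_of_tgt _ _
  have hi (L : CochainComplex D ℤ) [L.IsStrictlyLE n] : IsIso (L.iCycles n) :=
    L.isIso_iCycles n (n + 1) (by simp) (hd L)
  have h₁ := hi K
  have h₂ := hi ((CochainComplex.singleFunctor D n).obj X)
  have h₃ : IsIso (((CochainComplex.singleFunctor D n).obj X).homologyπ n) :=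
    HomologicalComplex.isIso_homologyπ _ (n - 1) n (by simp)
      ((((CochainComplex.singleFunctor D n).obj X).isZero_of_isStrictlyGE n (n - 1)
        (by lia)).eq_of_src _ _)
  have h₄ : Epi (HomologicalComplex.cyclesMap s n) := by
    have h : HomologicalComplex.cyclesMap s n ≫
        ((CochainComplex.singleFunctor D n).obj X).homologyπ n =
          K.homologyπ n ≫ HomologicalComplex.homologyMap s n := by simp
    have : Epi (HomologicalComplex.cyclesMap s n ≫
        ((CochainComplex.singleFunctor D n).obj X).homologyπ n) := by
      rw [h]; infer_instance
    rw [← Category.comp_id (HomologicalComplex.cyclesMap s n),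
      ← IsIso.hom_inv_id (((CochainComplex.singleFunctor D n).obj X).homologyπ n),
      ← Category.assoc]
    infer_instance
  have h₅ : Epi (K.iCycles n ≫ s.f n) := by
    rw [← HomologicalComplex.cyclesMap_i]; infer_instance
  exact epi_of_epi (K.iCycles n) (s.f n)

/-- Extension classes of positive degree are effaceable in the first variable. -/
lemma Abelian.Ext.exists_epi_mk₀_comp_eq_zero [HasExt.{w} D] {X Y : D} {n : ℕ}
    (e : Ext.{w} X Y (n + 1)) :
    ∃ (X' : D) (p : X' ⟶ X) (_ : Epi p), (mk₀ p).comp e (zero_add _) = 0 := by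
  let := HasDerivedCategory.standard D
  let σ := ((DerivedCategory.singleFunctors D).shiftIso ((n + 1 : ℕ) : ℤ) (-((n + 1 : ℕ) : ℤ)) 0
    (by simp)).app Y
  -- The class is a roof `X ← K → Y[n+1]` with `K` in degrees `≤ 0`; the epimorphism sought is `K^0
  -- ⟶ X`.
  obtain ⟨K, _, s, hs, g, fac⟩ := DerivedCategory.right_fac_of_isStrictlyLE
    (X := (CochainComplex.singleFunctor D 0).obj X)
    (Y := (CochainComplex.singleFunctor D (-((n + 1 : ℕ) : ℤ))).obj Y) (e.hom ≫ σ.hom) 0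
  rw [DerivedCategory.isIso_Q_map_iff_quasiIso] at hs
  have := CochainComplex.epi_f_of_quasiIso_single s
  let i : (CochainComplex.singleFunctor D 0).obj (K.X 0) ⟶ K :=
    HomologicalComplex.mkHomFromSingle (𝟙 _) (fun k hk ↦
      (K.isZero_of_isStrictlyLE 0 k (by simp at hk; lia)).eq_of_tgt _ _)
  let p : K.X 0 ⟶ X := s.f 0 ≫ (HomologicalComplex.singleObjXSelf (.up ℤ) 0 X).hom
  have hp : i ≫ s = (CochainComplex.singleFunctor D 0).map p := by
    apply HomologicalComplex.from_single_hom_ext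
    refine (HomologicalComplex.comp_f _ _ _).trans
      (Eq.trans ?_ (HomologicalComplex.single_map_f_self (.up ℤ) 0 p).symm)
    simp only [i, p, HomologicalComplex.mkHomFromSingle_f, Category.comp_id]
    exact congrArg (fun x ↦ (HomologicalComplex.singleObjXSelf (.up ℤ) 0 (K.X 0)).hom ≫ x)
      ((Category.assoc _ _ _).trans ((congrArg (fun x ↦ s.f 0 ≫ x) (Iso.hom_inv_id _)).trans
        (Category.comp_id _))).symm
  -- Positivity of the degree enters here: `Y` sits in degree `-(n+1) ≠ 0`.
  have hg : i ≫ g = 0 := by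
    apply HomologicalComplex.from_single_hom_ext
    exact (((CochainComplex.singleFunctor D (-((n + 1 : ℕ) : ℤ))).obj Y).isZero_of_isStrictlyLE
      (-((n + 1 : ℕ) : ℤ)) 0 (by lia)).eq_of_tgt _ _
  refine ⟨K.X 0, p, epi_comp' this (IsIso.epi_of_iso
    (HomologicalComplex.singleObjXSelf (.up ℤ) 0 X).hom), ?_⟩
  ext
  have key : (DerivedCategory.singleFunctor D 0).map p ≫ e.hom = 0 := by
    rw [← cancel_mono σ.hom, Category.assoc, Limits.zero_comp]
    refine (congrArg (fun x ↦ DerivedCategory.Q.map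
      ((CochainComplex.singleFunctor D 0).map p) ≫ x) fac).trans ?_
    rw [← hp, Functor.map_comp, Category.assoc, IsIso.hom_inv_id_assoc, ← Functor.map_comp, hg,
      Functor.map_zero]
    rfl
  rw [comp_hom, mk₀_hom, ShiftedHom.mk₀_comp, key, zero_hom]

end Effaceable

section ExactFunctor

universe w' v' u'

variable {C : Type u} [Category.{v} C] [Abelian C] {D : Type u'} [Category.{v'} D] [Abelian D]

/-- Let `F : C ⥤ D` be an exact functor such that every epimorphism onto `F.obj A` is dominated by
the image of an epimorphism onto `A`. Then every extension class of `F.obj A` by `B` is the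
pushforward of the image of an extension class of `A` by an object of `C`. -/
lemma Abelian.Ext.exists_mapExactFunctor_comp_mk₀ [HasExt.{w} C] [HasExt.{w'} D]
    (F : C ⥤ D) [F.Additive] [PreservesFiniteLimits F] [PreservesFiniteColimits F]
    (hF : ∀ (A : C) (Z : D) (f : Z ⟶ F.obj A) [Epi f],
      ∃ (A' : C) (p : A' ⟶ A) (_ : Epi p) (g : F.obj A' ⟶ Z), g ≫ f = F.map p)
    {B : D} {n : ℕ} (A : C) (e : Ext.{w'} (F.obj A) B n) :
    ∃ (B' : C) (e' : Ext.{w} A B' n) (f : F.obj B' ⟶ B),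
      e = (e'.mapExactFunctor F).comp (mk₀ f) (add_zero n) := by
  induction n generalizing A with
  | zero =>
    obtain ⟨f, rfl⟩ := (mk₀_bijective _ _).2 e
    exact ⟨A, mk₀ (𝟙 A), f, by simp [mapExactFunctor_mk₀]⟩
  | succ n ih =>
    obtain ⟨Z, q, _, hq⟩ := e.exists_epi_mk₀_comp_eq_zero
    obtain ⟨A', p, _, g, hg⟩ := hF A Z q
    have hS : (ShortComplex.mk _ _ (kernel.condition p)).ShortExact :=
      { exact := ShortComplex.exact_kernel p }
    obtain ⟨e₁, he₁⟩ := contravariant_sequence_exact₃ (hS.map_of_exact F) B e (by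
      change (mk₀ (F.map p)).comp e _ = 0
      rw [← hg, ← mk₀_comp_mk₀, comp_assoc _ _ _ _ (zero_add _) (by lia), hq, comp_zero])
      (add_comm 1 n)
    -- The induction passes from `A` to `kernel p`, hence the generalization over `A`.
    obtain ⟨B', e', f, hf⟩ := ih _ e₁
    refine ⟨B', hS.extClass.comp e' (add_comm 1 n), f, ?_⟩
    have h : (hS.extClass.comp e' (add_comm 1 n)).mapExactFunctor F =
        (hS.map_of_exact F).extClass.comp (e'.mapExactFunctor F) (add_comm 1 n) := by
      rw [mapExactFunctor_comp, mapExactFunctor_extClass]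
      rfl
    refine he₁.symm.trans (Eq.trans ?_ (congrArg (fun x ↦ x.comp (mk₀ f) (add_zero _)) h).symm)
    exact (congrArg (fun x ↦ (hS.map_of_exact F).extClass.comp x (add_comm 1 n)) hf).trans
      (comp_assoc_of_third_deg_zero _ _ _ _).symm

end ExactFunctor

section Ind

variable {C : Type u} [Category.{v} C]

/-- Morphisms in `Ind C` out of an object of `C` are the sections of the presheaf. -/
noncomputable def Ind.coyonedaObjYonedaObjIso (A : C) :
    coyoneda.obj (op (Ind.yoneda.obj A)) ≅ Ind.inclusion C ⋙ (evaluation _ _).obj (op A) :=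
  NatIso.ofComponents
    (fun X ↦ (Ind.inclusion.fullyFaithful.homEquiv.trans
      (((Ind.yonedaCompInclusion.app A).homCongr (Iso.refl _)).trans yonedaEquiv)).toIso)
    (fun f ↦ by
      ext
      simp [yonedaEquiv, Iso.homCongr, Functor.FullyFaithful.homEquiv])

/-- Both the inclusion into presheaves and evaluation at `A` preserve filtered colimits. -/
instance Ind.isFinitelyPresentable_yoneda_obj (A : C) :
    IsFinitelyPresentable.{v} (Ind.yoneda.obj A) := by
  rw [isFinitelyPresentable_iff_preservesFilteredColimits]
  refine ⟨fun J _ _ ↦ ?_⟩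
  exact preservesColimitsOfShape_of_natIso (Ind.coyonedaObjYonedaObjIso A).symm

variable [Abelian C]

instance Ind.additive_yoneda : (Ind.yoneda (C := C)).Additive :=
  Functor.additive_of_preserves_binary_products _

/-- Morphisms from an object of `C` to the target of an epimorphism of `Ind C` lift locally for
epimorphisms of `C`. -/
lemma Ind.exists_epi_lift {X Y : Ind C} (f : X ⟶ Y) [Epi f] {A : C} (a : Ind.yoneda.obj A ⟶ Y) :
    ∃ (A' : C) (p : A' ⟶ A) (_ : Epi p) (g : Ind.yoneda.obj A' ⟶ X),
      g ≫ f = Ind.yoneda.map p ≫ a := by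
  obtain ⟨I, _, _, F, G, φ, ⟨i⟩⟩ := Ind.exists_nonempty_arrow_mk_iso_ind_lim (f := f)
  have hi : f ≫ i.hom.right = i.hom.left ≫ (Ind.lim I).map φ := i.hom.w.symm
  have hepi : Epi ((Ind.lim I).map φ) := by
    have : Epi (i.hom.left ≫ (Ind.lim I).map φ) := by rw [← hi]; infer_instance
    exact epi_of_epi i.hom.left _
  have h0 : (Ind.lim I).map (cokernel.π φ) = 0 := by
    rw [← cancel_epi ((Ind.lim I).map φ), ← Functor.map_comp, cokernel.condition,
      Functor.map_zero, comp_zero]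
  let c (H : I ⥤ C) (j : I) : Ind.yoneda.obj (H.obj j) ⟶ (Ind.lim I).obj H :=
    colimit.ι (H ⋙ Ind.yoneda) j
  have hc {H H' : I ⥤ C} (ψ : H ⟶ H') (j : I) :
      c H j ≫ (Ind.lim I).map ψ = Ind.yoneda.map (ψ.app j) ≫ c H' j :=
    ι_colimMap _ _
  obtain ⟨j, b, hb⟩ := IsFinitelyPresentable.exists_hom_of_isColimit
    (colimit.isColimit (G ⋙ Ind.yoneda)) (a ≫ i.hom.right)
  replace hb : b ≫ c G j = a ≫ i.hom.right := hb
  -- The composite into the cokernel vanishes in the colimit, hence at some stage `k`. The two maps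
  -- `u`, `u'` may differ, harmlessly, as the second morphism is `0`.
  obtain ⟨k, u, u', huu'⟩ := IsFinitelyPresentable.exists_eq_of_isColimit
    (colimit.isColimit (cokernel φ ⋙ Ind.yoneda)) (i := j) (j := j)
    (b ≫ Ind.yoneda.map ((cokernel.π φ).app j)) 0 (by
      rw [Category.assoc, zero_comp]
      change b ≫ Ind.yoneda.map ((cokernel.π φ).app j) ≫ c (cokernel φ) j = 0
      rw [← hc, h0, comp_zero, comp_zero])
  obtain ⟨b, rfl⟩ := Ind.yoneda.map_surjective b
  have hk : (b ≫ G.map u) ≫ (cokernel.π φ).app k = 0 := by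
    apply Ind.yoneda.map_injective
    simpa using huu'
  -- Cokernels in `I ⥤ C` are computed stagewise, so at stage `k` the map lifts through `φ.app k`
  -- after an epimorphism of `C`.
  have hex : (ShortComplex.mk (φ.app k) ((cokernel.π φ).app k)
      (by rw [← NatTrans.comp_app, cokernel.condition]; rfl)).Exact :=
    (ShortComplex.exact_cokernel φ).map ((evaluation I C).obj k)
  obtain ⟨A', p, hp, x, hx⟩ := hex.exact_up_to_refinements _ hk
  refine ⟨A', p, hp, Ind.yoneda.map x ≫ c F k ≫ i.inv.left, ?_⟩
  have hGu : Ind.yoneda.map (G.map u) ≫ c G k = c G j := colimit.w (G ⋙ Ind.yoneda) u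
  have hx' : Ind.yoneda.map p ≫ Ind.yoneda.map b ≫ Ind.yoneda.map (G.map u) =
      Ind.yoneda.map x ≫ Ind.yoneda.map (φ.app k) := by
    simpa using congrArg Ind.yoneda.map hx
  have hl : i.inv.left ≫ i.hom.left = 𝟙 _ := by
    rw [← Arrow.comp_left, i.inv_hom_id]; rfl
  have hr : i.hom.right ≫ i.inv.right = 𝟙 _ := by
    rw [← Arrow.comp_right, i.hom_inv_id]; rfl
  have hmono : Mono i.hom.right := (SplitMono.mk i.inv.right hr).mono
  rw [← cancel_mono i.hom.right]
  simp only [Category.assoc]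
  rw [hi, reassoc_of% hl, hc, ← reassoc_of% hx', hGu, hb]

end Ind

section HomologicalDimension

variable {C : Type u} [Category.{v} C] [Abelian C]

lemma subsingleton_ext_of_homologicalDimension_lt {A : C} {n : ℕ}
    (hn : homologicalDimension A < (n : ℕ∞)) (B : C) :
    letI := HasExt.standard C
    Subsingleton (Ext.{max u v} A B n) := by
  let := HasExt.standard C
  by_contra h
  rw [not_subsingleton_iff_nontrivial] at h
  exact hn.not_ge (le_sSup ⟨n, rfl, B, h⟩)

end HomologicalDimension

end CategoryTheory

theorem lemma4p2 {C : Type u} [CategoryTheory.Category.{v} C] [CategoryTheory.Abelian C]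
    [CategoryTheory.EssentiallySmall.{v} C]
    (hNoeth : ∀ X : C, CategoryTheory.IsNoetherianObject X)
    [CategoryTheory.HasExt.{w} (CategoryTheory.Ind C)]
    (A : C) (n : ℕ) (hn : CategoryTheory.homologicalDimension A < (n : ℕ∞))
    (B : CategoryTheory.Ind C) :
    Subsingleton (CategoryTheory.Abelian.Ext.{w} (CategoryTheory.Ind.yoneda.obj A) B n) := by
  let := CategoryTheory.HasExt.standard C
  refine subsingleton_of_forall_eq 0 fun e ↦ ?_
  obtain ⟨B', e', f, rfl⟩ := CategoryTheory.Abelian.Ext.exists_mapExactFunctor_comp_mk₀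
    CategoryTheory.Ind.yoneda
    (fun A Z f _ ↦ by
      simpa using CategoryTheory.Ind.exists_epi_lift f (CategoryTheory.CategoryStruct.id _)) A e
  have := CategoryTheory.subsingleton_ext_of_homologicalDimension_lt hn B'
  rw [Subsingleton.elim e' 0, CategoryTheory.Abelian.Ext.mapExactFunctor_zero,
    CategoryTheory.Abelian.Ext.zero_comp]
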